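/- Let $k$ be a field of characteristic $0$, let $n\ge 1$, and let $p=(p_{ij})\in M_n(k)$ be a multiplicatively antisymmetric matrix ($p_{ii}=1$, $p_{ij}p_{ji}=1$) all of whose entries are roots of unity, not all equal to $1$. Let $S=k_p[x_1,\dots,x_n]$ be the $k$-algebra generated by $x_1,\dots,x_n$ subject to the relations $x_jx_i=p_{ij}x_ix_j$ for all $i,j$, and let $Z$ be its center. Write $p_{ij}=\xi^{b_{ij}}$, where $\xi\in k$ is a primitive $\ell$-th root of unity with $\ell$ minimal (so $\ell>1$) and $B=(b_{ij})$ is a skew-symmetric integer matrix with zero diagonal. 1. Let $n=2$. Then $Z=k[x_1^{\ell},x_2^{\ell}]$, the $k$-subalgebra of $S$ generated by $x_1^\ell$ and $x_2^\ell$, and $Z$ is a regular ring; moreover, $Z$ is a polynomial ring over $k$ in $2$ variables. 2. Let $n=3$. Then $Z$ is regular if and only if the multiplicative orders of $p_{12},p_{13},p_{23}$ are pairwise coprime. 3. Let $n=4$. Put $\rho=\gcd(\ell,\operatorname{pf}(B))$, where $\operatorname{pf}(B)=b_{12}b_{34}-b_{13}b_{24}+b_{14}b_{23}$ is the Pfaffian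 of $B$, let $\omega\in k$ be a primitive $\rho$-th root of unity, and put $q_{ij}=\omega^{\gcd(b_{ij},\rho)}$. Then $Z$ is regular if and only if the multiplicative orders of the six elements $q_{ij}$, $1\le i<j\le 4$, are pairwise coprime. Here "regular" means that $Z$ is Noetherian and its localization at every prime ideal is a regular local ring. The equivalences in 2 and 3 also hold with "$Z$ is regular" replaced by "$Z$ is isomorphic, as a $k$-algebra, to a polynomial ring over $k$ in $n$ variables". -/

import Mathlib

/-- The defining relations `x_j x_i = p_{ij} x_i x_j` of the skew polynomial ring. -/
inductive SkewPolyRel {k : Type*} [Field k] {n : ℕ} (p : Matrix (Fin n) (Fin n) k) :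
    FreeAlgebra k (Fin n) → FreeAlgebra k (Fin n) → Prop
  | comm (i j : Fin n) :
      SkewPolyRel p (FreeAlgebra.ι k j * FreeAlgebra.ι k i)
        (p i j • (FreeAlgebra.ι k i * FreeAlgebra.ι k j))

/-- The skew polynomial ring `S_p = k_p[x_1, …, x_n]`: the `k`-algebra generated by
`x_1, …, x_n` subject to the relations `x_j x_i = p_{ij} x_i x_j`. -/
abbrev SkewPoly {k : Type*} [Field k] {n : ℕ} (p : Matrix (Fin n) (Fin n) k) : Type _ :=
  RingQuot (SkewPolyRel p)

/-- The generator `x_i` of the skew polynomial ring. -/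
noncomputable def SkewPoly.x {k : Type*} [Field k] {n : ℕ} (p : Matrix (Fin n) (Fin n) k)
    (i : Fin n) : SkewPoly p :=
  RingQuot.mkAlgHom k (SkewPolyRel p) (FreeAlgebra.ι k i)

/-- The center `Z` of the skew polynomial ring `S_p`, as a `k`-subalgebra. -/
abbrev SkewPoly.center {k : Type*} [Field k] {n : ℕ} (p : Matrix (Fin n) (Fin n) k) :
    Subalgebra k (SkewPoly p) :=
  Subalgebra.center k (SkewPoly p)

/-- The standing setting: the parameters of `S_p` are written `p_{ij} = ξ ^ b_{ij}` with `ξ` a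
primitive `ℓ`-th root of unity and `B = (b_{ij})` a skew-symmetric integer matrix, where `ℓ > 1`
and `ℓ` is minimal among the orders of the roots of unity of which all `p_{ij}` are powers. -/
structure IsSkewPolyPresentation {k : Type*} [Field k] {n : ℕ} (p : Matrix (Fin n) (Fin n) k)
    (ξ : k) (ℓ : ℕ) (b : Matrix (Fin n) (Fin n) ℤ) : Prop where
  one_lt : 1 < ℓ
  primitive : IsPrimitiveRoot ξ ℓ
  diag_zero : ∀ i, b i i = 0
  skew : ∀ i j, b j i = -b i j
  param_eq : ∀ i j, p i j = ξ ^ b i j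
  minimal : ∀ (m : ℕ) (ζ : k) (c : Matrix (Fin n) (Fin n) ℤ), 0 < m → IsPrimitiveRoot ζ m →
    (∀ i j, p i j = ζ ^ c i j) → ℓ ≤ m

/-- The Pfaffian, by expansion along the first row:
`pf(A) = ∑_{k=2}^{n} (-1)^k a_{1k} pf(A_{\hat 1 \hat k})`. Rows and columns are numbered from `0`
here, so that the entry `a_{1,k}` with `k = j + 2` is `A 0 j.succ`. -/
def pfaffian {R : Type*} [CommRing R] : (n : ℕ) → Matrix (Fin n) (Fin n) R → R
  | 0, _ => 1
  | 1, _ => 0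
  | n + 2, A => ∑ j : Fin (n + 1), (-1) ^ (j : ℕ) * A 0 j.succ *
      pfaffian n (A.submatrix (fun i => (j.succAbove i).succ) (fun i => (j.succAbove i).succ))

/-- The orders of the members of the family `(q_{ij})_{i<j}` are pairwise coprime. -/
def PairwiseCoprimeOrders {k : Type*} [Field k] {n : ℕ} (q : Matrix (Fin n) (Fin n) k) : Prop :=
  {s : Fin n × Fin n | s.1 < s.2}.Pairwise
    fun s t => Nat.Coprime (orderOf (q s.1 s.2)) (orderOf (q t.1 t.2))

/-- The matrix `q_{ij} = ω ^ c_{ij}` with `c_{ij} = gcd(b_{ij}, ρ)`. -/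
def gcdPowerMatrix {k : Type*} [Field k] {n : ℕ} (b : Matrix (Fin n) (Fin n) ℤ) (ρ : ℕ) (ω : k) :
    Matrix (Fin n) (Fin n) k :=
  Matrix.of fun i j => ω ^ Int.gcd (b i j) (ρ : ℤ)

/-- `A` is a polynomial ring over `k` in `n` variables. -/
def IsPolynomialRingIn (k : Type*) [Field k] (n : ℕ) (A : Type*) [CommRing A] [Algebra k A] :
    Prop :=
  Nonempty (MvPolynomial (Fin n) k ≃ₐ[k] A)

/-! Ordered monomials form a basis of `S` and multiply up to nonzero scalars, so the center has as
basis the monomials whose exponents lie in the monoid `M` of solutions `s ∈ ℕ^n` of `B s ≡ 0 mod ℓ`.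

The center is regular exactly when `M = ∏ d_i ℕ` for positive `d_i`, and then it is a polynomial
ring (`isRegularRing_iff`, `isPolynomialRingIn_iff`). Since `M` contains each `ℓ e_i`, the maximal
ideal at the origin is minimal over `n` elements and has height at most `n`. Each irreducible
element of `M` gives an independent cotangent vector there, so regularity allows at most `n` of
them. The coordinate axes already use up `n`.

What remains is arithmetic. If the solutions modulo `N` are diagonal, every single term `b_ij v_j`
vanishes modulo `N` for each integer solution `v` (`HasDiagonalSolutions.dvd_mul`). Explicit
solutions, namely a kernel vector for `n = 3` and the columns of the Pfaffian adjugate for `n = 4`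
when `N ∣ pf(B)`, then make products of distinct entries vanish. A prime dividing two of the orders
would divide all entries, against the minimality of `ℓ`. Conversely, coprime orders allow the terms
of each congruence to be separated. For `n = 4` the adjugate also shows that solutions modulo `ℓ`
are divisible by `ℓ / ρ`, which reduces the modulus to `ρ` (`four_of_dvd`). For `n = 2`, minimality
makes `b_12` prime to `ℓ`, so `M = ℓ ℕ²`. -/

namespace SkewPoly

open Finset

/-! ### Commutation scalars and central exponents. -/

section Cocycle

variable {k : Type*} [Field k] {n : ℕ} (p : Matrix (Fin n) (Fin n) k)

/-- The bicharacter with `x^s * x^t = cocycle p s t • x^(s + t)` for ordered monomials. -/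
def cocycle (s t : Fin n → ℕ) : k :=
  ∏ i, ∏ j, if j < i then p j i ^ (s i * t j) else 1

lemma cocycle_add_left (s s' t : Fin n → ℕ) :
    cocycle p (s + s') t = cocycle p s t * cocycle p s' t := by
  simp only [cocycle, ← prod_mul_distrib]
  refine prod_congr rfl fun i _ => prod_congr rfl fun j _ => ?_
  split_ifs
  · rw [Pi.add_apply, add_mul, pow_add]
  · simp

lemma cocycle_add_right (s t t' : Fin n → ℕ) :
    cocycle p s (t + t') = cocycle p s t * cocycle p s t' := by
  simp only [cocycle, ← prod_mul_distrib]
  refine prod_congr rfl fun i _ => prod_congr rfl fun j _ => ?_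
  split_ifs
  · rw [Pi.add_apply, mul_add, pow_add]
  · simp

@[simp] lemma cocycle_zero_left (t : Fin n → ℕ) : cocycle p 0 t = 1 := by simp [cocycle]

@[simp] lemma cocycle_zero_right (s : Fin n → ℕ) : cocycle p s 0 = 1 := by simp [cocycle]

lemma cocycle_single_self (i : Fin n) (a b : ℕ) :
    cocycle p (Pi.single i a) (Pi.single i b) = 1 := by
  refine prod_eq_one fun u _ => prod_eq_one fun v _ => ?_
  split_ifs with h
  · by_cases hu : u = i
    · subst hu; simp [h.ne]
    · simp [hu]
  · rfl

variable {p}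

lemma cocycle_ne_zero (hp : ∀ i j, p i j * p j i = 1) (s t : Fin n → ℕ) :
    cocycle p s t ≠ 0 := by
  refine prod_ne_zero_iff.2 fun i _ => prod_ne_zero_iff.2 fun j _ => ?_
  split_ifs
  · exact pow_ne_zero _ (left_ne_zero_of_mul_eq_one (hp j i))
  · exact one_ne_zero

/-- The two cocycles run over opposite triangles of index pairs. Since `p i j * p j i = 1`, their
quotient is a product over all pairs, the diagonal contributing `1`. -/
lemma cocycle_swap (hp : ∀ i j, p i j * p j i = 1) (h1 : ∀ i, p i i = 1) (u s : Fin n → ℕ) :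
    cocycle p u s = cocycle p s u * ∏ i, (∏ j, p j i ^ s j) ^ u i := by
  have : cocycle p s u = ∏ i, ∏ j, if i < j then p i j ^ (s j * u i) else 1 := by
    rw [cocycle, prod_comm]
  rw [this, cocycle, ← prod_mul_distrib]
  refine prod_congr rfl fun i _ => ?_
  rw [← prod_pow, ← prod_mul_distrib]
  refine prod_congr rfl fun j _ => ?_
  rcases lt_trichotomy i j with h | h | h
  · rw [if_neg h.not_gt, if_pos h, ← pow_mul, ← mul_pow, hp, one_pow]
  · subst h; simp [h1]
  · rw [if_pos h, if_neg h.not_gt, ← pow_mul, one_mul, mul_comm (s j)]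

/-- The exponents of the monomials which are central in `SkewPoly p`. -/
def centralExponents (p : Matrix (Fin n) (Fin n) k) : AddSubmonoid (Fin n → ℕ) where
  carrier := {s | ∀ i, ∏ j, p j i ^ s j = 1}
  add_mem' {s t} hs ht i := by
    simp only [Set.mem_ofPred_eq] at hs ht
    simp [pow_add, prod_mul_distrib, hs i, ht i]
  zero_mem' i := by simp

lemma mem_centralExponents {s : Fin n → ℕ} :
    s ∈ centralExponents p ↔ ∀ i, ∏ j, p j i ^ s j = 1 := Iff.rfl

lemma mem_centralExponents_iff_cocycle (hp : ∀ i j, p i j * p j i = 1) (h1 : ∀ i, p i i = 1)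
    {s : Fin n → ℕ} :
    s ∈ centralExponents p ↔ ∀ u, cocycle p u s = cocycle p s u := by
  constructor
  · intro h u
    rw [cocycle_swap hp h1 u s]
    simp [mem_centralExponents.1 h]
  · intro h i
    -- Testing against a unit vector isolates the `i`-th condition.
    have := cocycle_swap hp h1 (Pi.single i 1) s
    rw [h, left_eq_mul₀ (cocycle_ne_zero hp _ _), Finset.prod_eq_single i] at this
    · simpa using this
    · intro j _ hj; simp [hj]
    · simp

end Cocycle

/-! ### The monomial bases of the skew polynomial ring and of its center. -/

section Monomials

variable {k : Type*} [Field k] {n : ℕ} {p : Matrix (Fin n) (Fin n) k}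

lemma x_mul_x (i j : Fin n) : x p j * x p i = p i j • (x p i * x p j) := by
  simpa [x] using! RingQuot.mkAlgHom_rel k (SkewPolyRel.comm (p := p) i j)

lemma adjoin_range_x : Algebra.adjoin k (Set.range (x p)) = ⊤ := by
  have : Set.range (x p) =
      RingQuot.mkAlgHom k (SkewPolyRel p) '' Set.range (FreeAlgebra.ι k) := by
    rw [← Set.range_comp]; rfl
  rw [this, ← AlgHom.map_adjoin, FreeAlgebra.adjoin_range_ι, Algebra.map_top,
    AlgHom.range_eq_top]
  exact RingQuot.mkAlgHom_surjective k _

/-- The operator of twisted translation by `s`. -/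
noncomputable def shift (p : Matrix (Fin n) (Fin n) k) (s : Fin n → ℕ) :
    Module.End k ((Fin n → ℕ) →₀ k) :=
  Finsupp.lsum k fun t => cocycle p s t • Finsupp.lsingle (s + t)

lemma shift_single (s t : Fin n → ℕ) (a : k) :
    shift p s (Finsupp.single t a) = Finsupp.single (s + t) (cocycle p s t * a) := by
  simp [shift]

lemma shift_mul_shift (s t : Fin n → ℕ) :
    shift p s * shift p t = cocycle p s t • shift p (s + t) := by
  refine Finsupp.lhom_ext fun u a => ?_
  simp only [Module.End.mul_apply, shift_single, LinearMap.smul_apply, Finsupp.smul_single,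
    smul_eq_mul, cocycle_add_left, cocycle_add_right, add_assoc]
  congr 1; ring

lemma shift_zero : shift p 0 = 1 := by
  refine Finsupp.lhom_ext fun u a => ?_
  simp [shift_single]

/-- The representation of `SkewPoly p` by twisted translations. -/
noncomputable def rep (hp : ∀ i j, p i j * p j i = 1) (h1 : ∀ i, p i i = 1) :
    SkewPoly p →ₐ[k] Module.End k ((Fin n → ℕ) →₀ k) :=
  RingQuot.liftAlgHom k ⟨FreeAlgebra.lift k fun i => shift p (Pi.single i 1), by
    rintro _ _ ⟨i, j⟩
    simp only [map_mul, map_smul, FreeAlgebra.lift_ι_apply, shift_mul_shift, smul_smul]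
    -- On two unit vectors the double product in `cocycle_swap` reduces to the single factor `p i
    -- j`.
    rw [add_comm (Pi.single j 1 : Fin n → ℕ), cocycle_swap hp h1 (Pi.single j 1),
      Finset.prod_eq_single j (by intro u _ hu; simp [hu]) (by simp),
      Finset.prod_eq_single i (by intro u _ hu; simp [hu]) (by simp)]
    simp [mul_comm]⟩

lemma rep_x (hp : ∀ i j, p i j * p j i = 1) (h1 : ∀ i, p i i = 1) (i : Fin n) :
    rep hp h1 (x p i) = shift p (Pi.single i 1) := by
  simp [rep, x]

/-- The product of the generators with indices in a list. -/
noncomputable def word (p : Matrix (Fin n) (Fin n) k) (l : List (Fin n)) : SkewPoly p :=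
  (l.map (x p)).prod

lemma word_perm (hp : ∀ i j, p i j * p j i = 1) {l l' : List (Fin n)} (h : l.Perm l') :
    ∃ u : k, u ≠ 0 ∧ word p l = u • word p l' := by
  induction h with
  | nil => exact ⟨1, one_ne_zero, by simp⟩
  | @cons i l l' _ ih =>
    obtain ⟨u, hu, h⟩ := ih
    refine ⟨u, hu, ?_⟩
    simp only [word, List.map_cons, List.prod_cons] at h ⊢
    rw [h, mul_smul_comm]
  | swap i j l =>
    refine ⟨p i j, left_ne_zero_of_mul_eq_one (hp i j), ?_⟩
    simp only [word, List.map_cons, List.prod_cons]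
    rw [← mul_assoc, x_mul_x, smul_mul_assoc, mul_assoc]
  | trans _ _ ih ih' =>
    obtain ⟨u, hu, h⟩ := ih
    obtain ⟨v, hv, h'⟩ := ih'
    exact ⟨u * v, mul_ne_zero hu hv, by rw [h, h', smul_smul]⟩

lemma rep_word (hp : ∀ i j, p i j * p j i = 1) (h1 : ∀ i, p i i = 1) (l : List (Fin n)) :
    ∃ u : k, u ≠ 0 ∧ rep hp h1 (word p l) = u • shift p (fun i => l.count i) := by
  induction l with
  | nil => exact ⟨1, one_ne_zero, by simpa [word] using! shift_zero.symm⟩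
  | cons i l ih =>
    obtain ⟨u, hu, h⟩ := ih
    refine ⟨u * cocycle p (Pi.single i 1) (fun i => l.count i),
      mul_ne_zero hu (cocycle_ne_zero hp _ _), ?_⟩
    have : word p (i :: l) = x p i * word p l := by simp [word]
    rw [this, map_mul, h, rep_x, mul_smul_comm, shift_mul_shift, smul_smul]
    congr 2
    ext j
    rcases eq_or_ne j i with rfl | hj
    · simp [add_comm]
    · simp [hj, hj.symm]

lemma exists_count_eq (s : Fin n → ℕ) : ∃ l : List (Fin n), (fun i => l.count i) = s := by
  refine ⟨(∑ i, Multiset.replicate (s i) i).toList, ?_⟩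
  ext i
  rw [← Multiset.coe_count, Multiset.coe_toList, Multiset.count_sum']
  simp [Multiset.count_replicate]

/-- Rescale a word with letter counts `s`. The link to words gives spanning, since words with equal
counts are proportional; the action by `shift p s` gives independence, on evaluation at
`Finsupp.single 0 1`. -/
lemma exists_monomial (hp : ∀ i j, p i j * p j i = 1) (h1 : ∀ i, p i i = 1) (s : Fin n → ℕ) :
    ∃ y : SkewPoly p, rep hp h1 y = shift p s ∧
      ∃ (l : List (Fin n)) (u : k), u ≠ 0 ∧ (fun i => l.count i) = s ∧ word p l = u • y := by
  obtain ⟨l, rfl⟩ := exists_count_eq s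
  obtain ⟨u, hu, h⟩ := rep_word hp h1 l
  refine ⟨u⁻¹ • word p l, ?_, l, u, hu, rfl, ?_⟩
  · rw [map_smul, h, smul_smul, inv_mul_cancel₀ hu, one_smul]
  · rw [smul_smul, mul_inv_cancel₀ hu, one_smul]

/-- The ordered monomial with exponent `s`. -/
noncomputable def monomial (hp : ∀ i j, p i j * p j i = 1) (h1 : ∀ i, p i i = 1)
    (s : Fin n → ℕ) : SkewPoly p :=
  (exists_monomial hp h1 s).choose

variable (hp : ∀ i j, p i j * p j i = 1) (h1 : ∀ i, p i i = 1)

lemma rep_monomial (s : Fin n → ℕ) : rep hp h1 (monomial hp h1 s) = shift p s :=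
  (exists_monomial hp h1 s).choose_spec.1

lemma word_mem_span (l : List (Fin n)) :
    word p l ∈ Submodule.span k (Set.range (monomial hp h1)) := by
  obtain ⟨l', u, -, hl, h⟩ := (exists_monomial hp h1 fun i => l.count i).choose_spec.2
  obtain ⟨v, -, hv⟩ := word_perm hp (List.perm_iff_count.2 fun i => (congrFun hl i).symm)
  rw [hv, h, smul_smul]
  exact Submodule.smul_mem _ _ (Submodule.subset_span ⟨_, rfl⟩)

lemma span_monomial : ⊤ ≤ Submodule.span k (Set.range (monomial hp h1)) := by
  rw [← Algebra.top_toSubmodule, ← adjoin_range_x, Algebra.adjoin_eq_span, Submodule.span_le]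
  intro y hy
  obtain ⟨l, hl, rfl⟩ := Submonoid.exists_list_of_mem_closure hy
  have : l ∈ Set.range (List.map (x p)) := by rw [Set.range_list_map]; exact hl
  obtain ⟨l, rfl⟩ := this
  exact word_mem_span hp h1 _

/-- Evaluation of the representation at the constant monomial. -/
noncomputable def symbol : SkewPoly p →ₗ[k] ((Fin n → ℕ) →₀ k) :=
  (LinearMap.applyₗ (Finsupp.single 0 1)).comp (rep hp h1).toLinearMap

lemma symbol_apply (y : SkewPoly p) :
    symbol hp h1 y = rep hp h1 y (Finsupp.single 0 1) := rfl

lemma symbol_monomial (s : Fin n → ℕ) :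
    symbol hp h1 (monomial hp h1 s) = Finsupp.single s 1 := by
  simp [symbol_apply, rep_monomial, shift_single]

/-- The basis of ordered monomials. -/
noncomputable def basis : Module.Basis (Fin n → ℕ) k (SkewPoly p) :=
  Module.Basis.mk (v := monomial hp h1)
    (LinearIndependent.of_comp (symbol hp h1) (by
      convert (Finsupp.basisSingleOne (R := k) (ι := Fin n → ℕ)).linearIndependent using 1
      ext1 s
      simp [symbol_monomial]))
    (span_monomial hp h1)

lemma basis_apply (s : Fin n → ℕ) : basis hp h1 s = monomial hp h1 s := by
  simp [basis]

lemma symbol_eq_repr : symbol hp h1 = (basis hp h1).repr.toLinearMap :=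
  (basis hp h1).ext fun s => by
    rw [LinearEquiv.coe_coe, Module.Basis.repr_self, basis_apply, symbol_monomial]

lemma rep_injective : Function.Injective (rep hp h1) := fun a b h =>
  (basis hp h1).repr.injective <| by
    rw [← LinearEquiv.coe_coe, ← symbol_eq_repr, symbol_apply, symbol_apply, h]

lemma monomial_mul_monomial (s t : Fin n → ℕ) :
    monomial hp h1 s * monomial hp h1 t = cocycle p s t • monomial hp h1 (s + t) :=
  rep_injective hp h1 <| by simp only [map_mul, map_smul, rep_monomial, shift_mul_shift]

lemma monomial_zero : monomial hp h1 0 = 1 :=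
  rep_injective hp h1 <| by rw [rep_monomial, shift_zero, map_one]

lemma x_pow_eq_monomial (i : Fin n) (m : ℕ) :
    x p i ^ m = monomial hp h1 (Pi.single i m) := by
  induction m with
  | zero => simp [monomial_zero]
  | succ m ih =>
    have : x p i = monomial hp h1 (Pi.single i 1) :=
      rep_injective hp h1 <| by rw [rep_x, rep_monomial]
    rw [pow_succ, ih, this, monomial_mul_monomial, cocycle_single_self, one_smul, Pi.single_add]

/-- Translation by `u` is injective on exponents, so only one coefficient of `f` contributes.
Comparison with right multiplication forces every exponent of a central element to be central. -/
lemma repr_monomial_mul (u s : Fin n → ℕ) (f : SkewPoly p) :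
    (basis hp h1).repr (monomial hp h1 u * f) (u + s) =
      cocycle p u s * (basis hp h1).repr f s := by
  have : (Finsupp.lapply (u + s)).comp ((basis hp h1).repr.toLinearMap.comp
      (LinearMap.mulLeft k (monomial hp h1 u))) =
      cocycle p u s • (Finsupp.lapply s).comp (basis hp h1).repr.toLinearMap := by
    refine (basis hp h1).ext fun t => ?_
    simp only [LinearMap.comp_apply, LinearMap.mulLeft_apply, LinearMap.smul_apply,
      LinearEquiv.coe_coe, Module.Basis.repr_self]
    rw [basis_apply, monomial_mul_monomial, ← basis_apply, map_smul, Module.Basis.repr_self]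
    rcases eq_or_ne t s with rfl | h
    · simp
    · simp [h.symm]
  exact LinearMap.congr_fun this f

lemma repr_mul_monomial (u s : Fin n → ℕ) (f : SkewPoly p) :
    (basis hp h1).repr (f * monomial hp h1 u) (u + s) =
      cocycle p s u * (basis hp h1).repr f s := by
  have : (Finsupp.lapply (u + s)).comp ((basis hp h1).repr.toLinearMap.comp
      (LinearMap.mulRight k (monomial hp h1 u))) =
      cocycle p s u • (Finsupp.lapply s).comp (basis hp h1).repr.toLinearMap := by
    refine (basis hp h1).ext fun t => ?_
    simp only [LinearMap.comp_apply, LinearMap.mulRight_apply, LinearMap.smul_apply,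
      LinearEquiv.coe_coe, Module.Basis.repr_self]
    rw [basis_apply, monomial_mul_monomial, ← basis_apply, map_smul, Module.Basis.repr_self,
      add_comm t u]
    rcases eq_or_ne t s with rfl | h
    · simp
    · simp [h.symm]
  exact LinearMap.congr_fun this f

lemma monomial_mem_center {s : Fin n → ℕ} (hs : s ∈ centralExponents p) :
    monomial hp h1 s ∈ center p := by
  rw [Subalgebra.mem_center_iff]
  intro f
  have : LinearMap.mulRight k (monomial hp h1 s) = LinearMap.mulLeft k (monomial hp h1 s) := by
    refine (basis hp h1).ext fun t => ?_
    rw [LinearMap.mulRight_apply, LinearMap.mulLeft_apply, basis_apply, monomial_mul_monomial,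
      monomial_mul_monomial, (mem_centralExponents_iff_cocycle hp h1).1 hs, add_comm]
  exact LinearMap.congr_fun this f

lemma mem_centralExponents_of_mem_support {f : SkewPoly p} (hf : f ∈ center p)
    {s : Fin n → ℕ} (hs : s ∈ ((basis hp h1).repr f).support) : s ∈ centralExponents p := by
  refine (mem_centralExponents_iff_cocycle hp h1).2 fun u => ?_
  have := repr_monomial_mul hp h1 u s f
  rw [Subalgebra.mem_center_iff.1 hf _, repr_mul_monomial] at this
  exact (mul_right_cancel₀ (Finsupp.mem_support_iff.1 hs) this).symm

/-- The basis of the center given by the central monomials. -/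
noncomputable def centerBasis : Module.Basis (centralExponents p) k (center p) :=
  Module.Basis.mk (v := fun s => ⟨monomial hp h1 s, monomial_mem_center hp h1 s.2⟩)
    (LinearIndependent.of_comp (center p).val.toLinearMap (by
      have : (center p).val.toLinearMap ∘ (fun s : centralExponents p =>
          (⟨monomial hp h1 s, monomial_mem_center hp h1 s.2⟩ : center p)) =
          basis hp h1 ∘ Subtype.val := by
        ext1 s
        simp [basis_apply]
      rw [this]
      exact (basis hp h1).linearIndependent.comp _ Subtype.val_injective))
    (by
      rintro ⟨f, hf⟩ -
      have key : (⟨f, hf⟩ : center p) = ∑ s ∈ ((basis hp h1).repr f).support.attach,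
          (basis hp h1).repr f s.1 • (⟨monomial hp h1 s.1, monomial_mem_center hp h1
            (mem_centralExponents_of_mem_support hp h1 hf s.2)⟩ : center p) := by
        apply Subtype.ext
        rw [← Subalgebra.coe_val, map_sum]
        simp only [map_smul, Subalgebra.coe_val]
        rw [Finset.sum_attach _ fun s => (basis hp h1).repr f s • monomial hp h1 s]
        conv_lhs => rw [← (basis hp h1).linearCombination_repr f]
        simp [Finsupp.linearCombination_apply, Finsupp.sum, basis_apply]
      rw [key]
      exact Submodule.sum_mem _ fun s _ => Submodule.smul_mem _ _
        (Submodule.subset_span ⟨⟨s.1, mem_centralExponents_of_mem_support hp h1 hf s.2⟩, rfl⟩))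

lemma coe_centerBasis (s : centralExponents p) :
    (centerBasis hp h1 s : SkewPoly p) = monomial hp h1 s := by
  simp [centerBasis]

end Monomials

end SkewPoly

/-! ### Commutative algebras with a twisted monoid basis. -/

/-- `z` is a basis of a `k`-algebra indexed by a submonoid of `ℕ ^ n` which is multiplicative up
to the nonzero scalars `c`. -/
structure IsTwistedMonoidBasis {k A : Type*} [Field k] [CommRing A] [Algebra k A] {n : ℕ}
    {M : AddSubmonoid (Fin n → ℕ)} (z : Module.Basis M k A) (c : M → M → k) : Prop where
  ne_zero : ∀ s t, c s t ≠ 0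
  basis_zero : z 0 = 1
  mul : ∀ s t, z s * z t = c s t • z (s + t)

namespace IsTwistedMonoidBasis

variable {k A : Type*} [Field k] [CommRing A] [Algebra k A] {n : ℕ}
  {M : AddSubmonoid (Fin n → ℕ)}

lemma mem_of_dvd {d : Fin n → ℕ} (h : ∀ i, Pi.single i (d i) ∈ M) {s : Fin n → ℕ}
    (hs : ∀ i, d i ∣ s i) : s ∈ M := by
  have : s = ∑ i, (s i / d i) • (Pi.single i (d i) : Fin n → ℕ) := by
    ext j
    simp [Finset.sum_apply, Pi.single_apply, Nat.div_mul_cancel (hs j)]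
  rw [this]
  exact sum_mem fun i _ => nsmul_mem (h i) _

variable {z : Module.Basis M k A} {c : M → M → k}

lemma right_zero (h : IsTwistedMonoidBasis z c) (s : M) : c s 0 = 1 := by
  have h2 := h.mul s 0
  rw [h.basis_zero, mul_one, add_zero] at h2
  exact (smul_left_injective k (z.ne_zero s) (by simpa using h2)).symm

lemma left_zero (h : IsTwistedMonoidBasis z c) (s : M) : c 0 s = 1 := by
  have h2 := h.mul 0 s
  rw [h.basis_zero, one_mul, zero_add] at h2
  exact (smul_left_injective k (z.ne_zero s) (by simpa using h2)).symm

lemma exists_pow_eq (h : IsTwistedMonoidBasis z c) (s : M) (m : ℕ) :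
    ∃ u : k, u ≠ 0 ∧ z s ^ m = u • z (m • s) := by
  induction m with
  | zero => exact ⟨1, one_ne_zero, by simp [h.basis_zero]⟩
  | succ m ih =>
    obtain ⟨u, hu, e⟩ := ih
    exact ⟨u * c (m • s) s, mul_ne_zero hu (h.ne_zero _ _), by
      rw [pow_succ, e, smul_mul_assoc, h.mul, smul_smul, succ_nsmul]⟩

section Polynomial

variable {d : Fin n → ℕ}

lemma exists_aeval_monomial_eq (h : IsTwistedMonoidBasis z c)
    (φ : (Fin n →₀ ℕ) →+ M) (s : Fin n →₀ ℕ) :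
    ∃ u : k, u ≠ 0 ∧ MvPolynomial.aeval (fun i => z (φ (Finsupp.single i 1)))
      (MvPolynomial.monomial s (1 : k)) = u • z (φ s) := by
  induction s using Finsupp.induction_linear with
  | zero => exact ⟨1, one_ne_zero, by simp [h.basis_zero]⟩
  | add s t hs ht =>
    obtain ⟨u, hu, e⟩ := hs
    obtain ⟨v, hv, e'⟩ := ht
    refine ⟨u * v * c (φ s) (φ t), mul_ne_zero (mul_ne_zero hu hv) (h.ne_zero _ _), ?_⟩
    rw [← one_mul (1 : k), ← MvPolynomial.monomial_mul, map_mul, e, e', smul_mul_smul_comm, h.mul,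
      smul_smul, φ.map_add]
  | single i m =>
    obtain ⟨u, hu, e⟩ := h.exists_pow_eq (φ (Finsupp.single i 1)) m
    refine ⟨u, hu, ?_⟩
    rw [← MvPolynomial.X_pow_eq_monomial, map_pow, MvPolynomial.aeval_X, e, ← map_nsmul,
      Finsupp.smul_single, smul_eq_mul, mul_one]

/-- Monomials go to nonzero multiples of basis elements, so a basis goes to a basis; the scalars `c`
never need to be normalized away. -/
lemma aeval_bijective (h : IsTwistedMonoidBasis z c) (φ : (Fin n →₀ ℕ) ≃+ M) :
    Function.Bijective (MvPolynomial.aeval (R := k)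
      (fun i => z (φ (Finsupp.single i 1)))) := by
  choose u hu e using h.exists_aeval_monomial_eq φ.toAddMonoidHom
  let b := (z.reindex φ.symm.toEquiv).unitsSMul fun s => Units.mk0 (u s) (hu s)
  have : (MvPolynomial.aeval (R := k) (fun i => z (φ (Finsupp.single i 1)))).toLinearMap =
      ((MvPolynomial.basisMonomials (Fin n) k).equiv b (Equiv.refl _)).toLinearMap := by
    refine (MvPolynomial.basisMonomials (Fin n) k).ext fun s => ?_
    rw [LinearEquiv.coe_coe, Module.Basis.equiv_apply, MvPolynomial.coe_basisMonomials]
    exact (e s).trans (by simp [b, Module.Basis.unitsSMul_apply, Units.smul_def])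
  have h2 := ((MvPolynomial.basisMonomials (Fin n) k).equiv b (Equiv.refl _)).bijective
  rw [← LinearEquiv.coe_coe, ← this] at h2
  exact h2

/-- The parametrization of a product of the submonoids `d i * ℕ`. -/
noncomputable def scaleEquiv (hd : ∀ i, 0 < d i) (hM : ∀ s, s ∈ M ↔ ∀ i, d i ∣ s i) :
    (Fin n →₀ ℕ) ≃+ M :=
  AddEquiv.ofBijective
    ({ toFun := fun s => ⟨fun i => d i * s i, (hM _).2 fun i => dvd_mul_right _ _⟩
       map_zero' := by ext; simp
       map_add' := fun s t => by ext; simp [mul_add] } : (Fin n →₀ ℕ) →+ M)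
    ⟨fun s t hst => by
      ext i
      exact Nat.eq_of_mul_eq_mul_left (hd i) (congrFun (congrArg Subtype.val hst) i),
    fun ⟨s, hs⟩ => ⟨Finsupp.equivFunOnFinite.symm fun i => s i / d i, by
      ext i
      exact Nat.mul_div_cancel' ((hM s).1 hs i)⟩⟩

lemma scaleEquiv_single (hd : ∀ i, 0 < d i) (hM : ∀ s, s ∈ M ↔ ∀ i, d i ∣ s i) (i : Fin n) :
    (scaleEquiv hd hM (Finsupp.single i 1) : Fin n → ℕ) = Pi.single i (d i) := by
  ext j
  change d j * Finsupp.single i 1 j = _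
  rcases eq_or_ne j i with rfl | hj
  · simp
  · simp [hj]

lemma isPolynomialRingIn (h : IsTwistedMonoidBasis z c) (hd : ∀ i, 0 < d i)
    (hM : ∀ s, s ∈ M ↔ ∀ i, d i ∣ s i) : IsPolynomialRingIn k n A :=
  ⟨AlgEquiv.ofBijective _ (h.aeval_bijective (scaleEquiv hd hM))⟩

end Polynomial

/-! ### Regularity at the origin and irreducible exponents. -/

section Regular

variable {ι : Type*}

open TrivSqZeroExt

open Classical in
/-- Truncation of the algebra to its constant term and its coefficients at irreducible elements of
the monoid. -/
noncomputable def truncation (h : IsTwistedMonoidBasis z c) (a : ι → M) (ha : ∀ i, a i ≠ 0)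
    (irr : ∀ i s t, s + t = a i → s = 0 ∨ t = 0) : A →ₐ[k] TrivSqZeroExt k (ι → k) :=
  AlgHom.ofLinearMap
    (z.constr k fun s => inl (if s = 0 then 1 else 0) + inr fun i => if s = a i then 1 else 0)
    (by
      rw [← h.basis_zero, Module.Basis.constr_basis]
      ext i
      · simp
      · simp [(ha i).symm])
    (by
      rw [LinearMap.map_mul_iff]
      refine z.ext fun s => z.ext fun t => ?_
      simp only [LinearMap.compr₂_apply, LinearMap.mul_apply', h.mul, map_smul, Module.Basis.constr_basis]
      have h0 : ∀ i, ¬ 0 = a i := fun i e => ha i e.symm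
      by_cases hs : s = 0
      · subst hs
        by_cases ht : t = 0 <;> ext i <;> simp [h.left_zero, h0, ht]
      by_cases ht : t = 0
      · subst ht
        ext i <;> simp [h.right_zero, h0, hs]
      have hst : s + t ≠ 0 := by
        intro e
        apply hs
        ext i
        have := congrFun (congrArg Subtype.val e) i
        simp at this
        exact this.1
      have hsta : ∀ i, ¬ s + t = a i := fun i e => (irr i s t e).elim hs ht
      ext i <;> simp [hs, ht, hst, hsta])

open Classical in
lemma truncation_basis (h : IsTwistedMonoidBasis z c) (a : ι → M) (ha : ∀ i, a i ≠ 0)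
    (irr : ∀ i s t, s + t = a i → s = 0 ∨ t = 0) (s : M) :
    h.truncation a ha irr (z s) =
      inl (if s = 0 then 1 else 0) + inr fun i => if s = a i then 1 else 0 := by
  simp [truncation]

variable {ℓ : ℕ}

/-- If `s i ≠ 0`, then `ℓ • s` is `ℓ e_i` plus an element of `M`, so the power `z s ^ ℓ` is a
multiple of a generator in `q`. -/
lemma basis_mem_of_single_mem (h : IsTwistedMonoidBasis z c)
    (hM : ∀ i, Pi.single i ℓ ∈ M) {q : Ideal A} [q.IsPrime]
    (hq : ∀ i, z ⟨Pi.single i ℓ, hM i⟩ ∈ q) {s : M} (hs : s ≠ 0) : z s ∈ q := by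
  obtain ⟨i, hi⟩ : ∃ i, s.1 i ≠ 0 := by
    by_contra! H
    exact hs (Subtype.ext (funext H))
  obtain ⟨u, hu, e⟩ := h.exists_pow_eq s ℓ
  let t : M := ⟨ℓ • (s.1 - Pi.single i 1), mem_of_dvd (d := fun _ => ℓ) hM fun j => by simp⟩
  have hst : ℓ • s = ⟨Pi.single i ℓ, hM i⟩ + t := by
    ext j
    simp only [t, AddSubmonoidClass.coe_nsmul, AddSubmonoid.coe_add, Pi.smul_apply, Pi.add_apply,
      Pi.sub_apply, smul_eq_mul]
    rcases eq_or_ne j i with rfl | hj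
    · obtain ⟨m, hm⟩ := Nat.exists_eq_succ_of_ne_zero hi
      simp only [hm, Pi.single_eq_same, Nat.succ_sub_one]
      rw [Nat.mul_succ, add_comm]
    · simp [hj]
  refine ‹q.IsPrime›.mem_of_pow_mem ℓ ?_
  have key := h.mul ⟨Pi.single i ℓ, hM i⟩ t
  rw [← hst] at key
  rw [e, ← inv_smul_smul₀ (h.ne_zero ⟨Pi.single i ℓ, hM i⟩ t) (z (ℓ • s)), ← key]
  exact Submodule.smul_of_tower_mem _ _ (Submodule.smul_of_tower_mem _ _
    (Ideal.mul_mem_right _ _ (hq i)))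

/-- A prime containing these `n` elements contains `z s` for all `s ≠ 0`, so its quotient map
factors through `ε`. This bounds the height of the kernel by `n`. -/
lemma ker_mem_minimalPrimes (h : IsTwistedMonoidBasis z c) (hℓ : 0 < ℓ)
    (hM : ∀ i, Pi.single i ℓ ∈ M) (ε : A →ₐ[k] k) (hε : ∀ s, s ≠ 0 → ε (z s) = 0) :
    RingHom.ker ε ∈ (Ideal.span (Set.range fun i => z ⟨Pi.single i ℓ, hM i⟩)).minimalPrimes := by
  refine ⟨⟨RingHom.ker_isPrime ε, ?_⟩, ?_⟩
  · rw [Ideal.span_le]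
    rintro _ ⟨i, rfl⟩
    exact hε _ fun e => by
      have := congrFun (congrArg Subtype.val e) i
      simp at this
      omega
  · rintro q ⟨hq, hle⟩ - f hf
    have hz : ∀ i, z ⟨Pi.single i ℓ, hM i⟩ ∈ q := fun i => hle (Ideal.subset_span ⟨i, rfl⟩)
    have : (Ideal.Quotient.mkₐ k q).toLinearMap =
        ((Algebra.ofId k (A ⧸ q)).comp ε).toLinearMap := by
      refine z.ext fun s => ?_
      by_cases hs : s = 0
      · simp [hs, h.basis_zero]
      · have : (Ideal.Quotient.mkₐ k q) (z s) = 0 :=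
          Ideal.Quotient.eq_zero_iff_mem.2 (h.basis_mem_of_single_mem hM hz hs)
        simp [this, hε s hs]
    have hf' := LinearMap.congr_fun this f
    have hf0 : ε f = 0 := hf
    simp only [AlgHom.toLinearMap_apply, AlgHom.comp_apply, hf0] at hf'
    exact Ideal.Quotient.eq_zero_iff_mem.1 (hf'.trans (map_zero _))

/-- Regularity makes the maximal ideal of the local ring at the origin generated by at most `n`
elements. The truncation extends to that ring, and its square-zero part maps the maximal ideal onto
`ι → k`, spanned by the images of the generators. -/
lemma card_irreducible_le [Fintype ι] [IsRegularRing A] (h : IsTwistedMonoidBasis z c)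
    (hℓ : 0 < ℓ) (hM : ∀ i, Pi.single i ℓ ∈ M) (a : ι → M) (hinj : Function.Injective a)
    (ha : ∀ i, a i ≠ 0) (irr : ∀ i s t, s + t = a i → s = 0 ∨ t = 0) : Fintype.card ι ≤ n := by
  classical
  let θ := h.truncation a ha irr
  let ε : A →ₐ[k] k := (fstHom k k (ι → k)).comp θ
  have hε : ∀ f, ε f = (θ f).fst := fun _ => rfl
  have hmin := h.ker_mem_minimalPrimes hℓ hM ε fun s hs => by
    simp [hε, θ, truncation_basis, hs]
  set 𝔪 := RingHom.ker ε with h𝔪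
  have : 𝔪.IsPrime := RingHom.ker_isPrime ε
  let R := Localization.AtPrime 𝔪
  have hunit : ∀ y : 𝔪.primeCompl, IsUnit (θ.toRingHom y) := fun y => by
    rw [isUnit_iff_isUnit_fst, isUnit_iff_ne_zero]
    exact fun e => y.2 ((RingHom.mem_ker (f := ε)).2 e)
  let Θ : R →+* TrivSqZeroExt k (ι → k) := IsLocalization.lift hunit
  have hΘ : ∀ f, Θ (algebraMap A R f) = θ f := fun f => IsLocalization.lift_eq hunit f
  have hfst : ∀ r ∈ IsLocalRing.maximalIdeal R, (Θ r).fst = 0 := by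
    have : IsLocalRing.maximalIdeal R ≤
        RingHom.ker ((fstHom k k (ι → k)).toRingHom.comp Θ) := by
      rw [← Localization.AtPrime.map_eq_maximalIdeal, Ideal.map_le_iff_le_comap]
      intro f hf
      change (Θ (algebraMap A R f)).fst = 0
      rw [hΘ]
      exact hf
    exact fun r hr => this hr
  have hfg : Submodule.FG (IsLocalRing.maximalIdeal R) := IsNoetherian.noetherian _
  let G := (IsLocalRing.maximalIdeal R).generators
  have hGfin : G.Finite := Submodule.FG.finite_generators hfg
  have hG : Submodule.span R G = IsLocalRing.maximalIdeal R := Submodule.span_generators _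
  have hGn : G.ncard ≤ n := by
    have h1 : G.ncard = (IsLocalRing.maximalIdeal R).spanFinrank := Submodule.FG.generators_ncard hfg
    have h2 := ‹IsRegularRing A›.isRegularLocalRing_localization 𝔪 |>.spanFinrank_maximalIdeal
    rw [IsLocalization.AtPrime.ringKrullDim_eq_height 𝔪, ← h1] at h2
    have h3 := Ideal.height_le_card_of_mem_minimalPrimes_span (Set.finite_range _) hmin
    have h4 : (Set.range fun i => z ⟨Pi.single i ℓ, hM i⟩).ncard ≤ n := by
      rw [← Set.image_univ]
      refine (Set.ncard_image_le Set.finite_univ).trans ?_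
      simp [Set.ncard_univ]
    have h5 : ((G.ncard : ℕ∞) : WithBot ℕ∞) = 𝔪.height := h2
    have h6 : (G.ncard : ℕ∞) = 𝔪.height := WithBot.coe_injective h5
    have h7 : (G.ncard : ℕ∞) ≤ n := h6 ▸ h3.trans (by exact_mod_cast h4)
    exact_mod_cast h7
  let V : Submodule k (ι → k) := Submodule.span k ((fun r => (Θ r).snd) '' G)
  have hV : ∀ r ∈ IsLocalRing.maximalIdeal R, (Θ r).snd ∈ V := by
    intro r hr
    rw [← hG] at hr
    induction hr using Submodule.span_induction with
    | mem r hr => exact Submodule.subset_span ⟨r, hr, rfl⟩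
    | zero => simp
    | add x y _ _ hx hy => rw [map_add, snd_add]; exact V.add_mem hx hy
    -- Since `x` has zero constant term, the product rule leaves only the constant term of `b` times
    -- the linear part of `x`.
    | smul b x hx hxV =>
      rw [hG] at hx
      rw [smul_eq_mul, map_mul, snd_mul, hfst x hx]
      simpa using V.smul_mem _ hxV
  have htop : V = ⊤ := by
    rw [eq_top_iff, ← (Pi.basisFun k ι).span_eq, Submodule.span_le]
    rintro _ ⟨i, rfl⟩
    have hmem : algebraMap A R (z (a i)) ∈ IsLocalRing.maximalIdeal R := by
      rw [← Localization.AtPrime.map_eq_maximalIdeal]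
      refine Ideal.mem_map_of_mem _ ?_
      change ε (z (a i)) = 0
      simp [hε, θ, truncation_basis, ha]
    have := hV _ hmem
    rw [hΘ] at this
    have e : Pi.basisFun k ι i = (θ (z (a i))).snd := by
      ext j
      simp [θ, truncation_basis, Pi.single_apply, hinj.eq_iff, eq_comm]
    rw [e]
    exact this
  have hfin : ((fun r => (Θ r).snd) '' G).Finite := hGfin.image _
  have hrank : Module.finrank k V ≤ ((fun r => (Θ r).snd) '' G).ncard := by
    have := hfin.fintype
    rw [Set.ncard_eq_toFinset_card']
    exact finrank_span_le_card _
  rw [htop, finrank_top, Module.finrank_pi] at hrank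
  exact hrank.trans ((Set.ncard_image_le hGfin).trans hGn)

/-- With `d i` the least positive multiple of `e_i` in `M`, the `n` vectors `d i • e_i` are
irreducible. A non-diagonal element of least coordinate sum would be one more irreducible. -/
theorem exists_dvd_of_isRegularRing [IsRegularRing A] (h : IsTwistedMonoidBasis z c)
    (hℓ : 0 < ℓ) (hM : ∀ i, Pi.single i ℓ ∈ M) :
    ∃ d : Fin n → ℕ, (∀ i, 0 < d i) ∧ ∀ s, s ∈ M ↔ ∀ i, d i ∣ s i := by
  classical
  have hex : ∀ i : Fin n, ∃ m, 0 < m ∧ Pi.single i m ∈ M := fun i => ⟨ℓ, hℓ, hM i⟩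
  let d : Fin n → ℕ := fun i => Nat.find (hex i)
  have hd : ∀ i, 0 < d i := fun i => (Nat.find_spec (hex i)).1
  have hdM : ∀ i, Pi.single i (d i) ∈ M := fun i => (Nat.find_spec (hex i)).2
  have hmin : ∀ i m, 0 < m → Pi.single i m ∈ M → d i ≤ m :=
    fun i m h1 h2 => Nat.find_min' (hex i) ⟨h1, h2⟩
  refine ⟨d, hd, fun s => ⟨?_, mem_of_dvd hdM⟩⟩
  induction hN : ∑ i, s i using Nat.strong_induction_on generalizing s with
  | _ N ih =>
  intro hs
  by_contra hbad
  have lt : ∀ {t u : Fin n → ℕ}, t + u = s → u ≠ 0 → ∑ i, t i < N := by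
    intro t u e hu
    rw [← hN, ← e]
    simp only [Pi.add_apply, Finset.sum_add_distrib]
    have : 0 < ∑ i, u i := by
      by_contra! H
      exact hu (funext fun i => by
        simpa using (Finset.sum_eq_zero_iff.1 (Nat.le_zero.1 H)) i (Finset.mem_univ i))
    omega
  -- These are `n + 1` candidate irreducibles: `none` stands for the bad element `s`, `some i` for
  -- the axis generators.
  let a : Option (Fin n) → M := fun o => o.elim ⟨s, hs⟩ fun i => ⟨Pi.single i (d i), hdM i⟩
  have hgood : ∀ i j, d j ∣ (Pi.single i (d i) : Fin n → ℕ) j := fun i j => by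
    rcases eq_or_ne j i with rfl | hj
    · simp
    · simp [hj]
  have := h.card_irreducible_le hℓ hM a ?_ ?_ ?_
  · simp at this
  · rintro (_ | i) (_ | j) e
    · rfl
    · have e : s = Pi.single j (d j) := congrArg Subtype.val e
      exact (hbad fun l => by rw [e]; exact hgood j l).elim
    · have e : Pi.single i (d i) = s := congrArg Subtype.val e
      exact (hbad fun l => by rw [← e]; exact hgood i l).elim
    · by_contra hij
      have e1 : (Pi.single i (d i) : Fin n → ℕ) = Pi.single j (d j) := congrArg Subtype.val e
      have := congrFun e1 i
      have hij : i ≠ j := fun e => hij (congrArg some e)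
      rw [Pi.single_eq_same, Pi.single_eq_of_ne hij] at this
      exact (hd i).ne' this
  · rintro (_ | i) e
    · have e : s = 0 := congrArg Subtype.val e
      exact hbad fun i => by simp [e]
    · have e1 : (Pi.single i (d i) : Fin n → ℕ) = 0 := congrArg Subtype.val e
      have := congrFun e1 i
      rw [Pi.single_eq_same] at this
      exact (hd i).ne' this
  · rintro (_ | i) ⟨t, ht⟩ ⟨u, hu⟩ e
    · by_contra! H
      have e : t + u = s := congrArg Subtype.val e
      have ht0 : t ≠ 0 := fun e => H.1 (Subtype.ext e)
      have hu0 : u ≠ 0 := fun e => H.2 (Subtype.ext e)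
      have h1 := ih _ (lt e hu0) t rfl ht
      have h2 := ih _ (lt ((add_comm u t).trans e) ht0) u rfl hu
      exact hbad (e ▸ fun i => dvd_add (h1 i) (h2 i))
    · have e : t + u = Pi.single i (d i) := congrArg Subtype.val e
      have hoff : ∀ j, j ≠ i → t j = 0 ∧ u j = 0 := fun j hj => by
        have := congrFun e j
        simpa [hj] using this
      have hi : t i + u i = d i := by simpa using congrFun e i
      have ht1 : t = Pi.single i (t i) := by
        ext j
        rcases eq_or_ne j i with rfl | hj
        · simp
        · simp [hj, hoff j hj]
      by_cases h0 : t i = 0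
      · exact Or.inl (Subtype.ext (ht1.trans (by rw [h0]; simp)))
      · right
        have := hmin i (t i) (Nat.pos_of_ne_zero h0) (ht1 ▸ ht)
        ext j
        rcases eq_or_ne j i with rfl | hj
        · change u j = 0
          omega
        · exact (hoff j hj).2

theorem isRegularRing_iff (h : IsTwistedMonoidBasis z c)
    (hℓ : 0 < ℓ) (hM : ∀ i, Pi.single i ℓ ∈ M) :
    IsRegularRing A ↔ ∃ d : Fin n → ℕ, (∀ i, 0 < d i) ∧ ∀ s, s ∈ M ↔ ∀ i, d i ∣ s i := by
  refine ⟨fun _ => h.exists_dvd_of_isRegularRing hℓ hM, fun ⟨d, hd, hdM⟩ => ?_⟩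
  obtain ⟨e⟩ := h.isPolynomialRingIn hd hdM
  exact IsRegularRing.of_ringEquiv e.toRingEquiv

theorem isPolynomialRingIn_iff (h : IsTwistedMonoidBasis z c)
    (hℓ : 0 < ℓ) (hM : ∀ i, Pi.single i ℓ ∈ M) :
    IsPolynomialRingIn k n A ↔
      ∃ d : Fin n → ℕ, (∀ i, 0 < d i) ∧ ∀ s, s ∈ M ↔ ∀ i, d i ∣ s i := by
  refine ⟨fun ⟨e⟩ => ?_, fun ⟨d, hd, hdM⟩ => h.isPolynomialRingIn hd hdM⟩
  have := IsRegularRing.of_ringEquiv e.toRingEquiv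
  exact h.exists_dvd_of_isRegularRing hℓ hM

end Regular

end IsTwistedMonoidBasis

/-! ### Linear congruences with diagonal solution monoid. -/

/-- The solutions in `ℕ ^ n` of the system `b s ≡ 0` modulo `N` are the vectors whose `i`-th
coordinate is divisible by `d i`, for some positive `d`. -/
def HasDiagonalSolutions {n : ℕ} (N : ℕ) (b : Matrix (Fin n) (Fin n) ℤ) : Prop :=
  ∃ d : Fin n → ℕ, (∀ i, 0 < d i) ∧
    ∀ s : Fin n → ℕ, (∀ i, (N : ℤ) ∣ ∑ j, b i j * s j) ↔ ∀ i, d i ∣ s i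

namespace HasDiagonalSolutions

variable {n N : ℕ} {b : Matrix (Fin n) (Fin n) ℤ}

/-- After reduction of `v` to nonnegative residues, a diagonal solution monoid contains each
coordinate component of the solution separately. -/
lemma dvd_mul (h : HasDiagonalSolutions N b) (hN : 0 < N) {v : Fin n → ℤ}
    (hv : ∀ i, (N : ℤ) ∣ ∑ j, b i j * v j) (i j : Fin n) : (N : ℤ) ∣ b i j * v j := by
  obtain ⟨d, -, hd⟩ := h
  let s : Fin n → ℕ := fun j => (v j % N).toNat
  have hs : ∀ j, (N : ℤ) ∣ v j - s j := fun j => by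
    have : (s j : ℤ) = v j % N := Int.toNat_of_nonneg (Int.emod_nonneg _ (by omega))
    rw [this]
    exact Int.dvd_self_sub_emod
  have h1 : ∀ i, d i ∣ s i := (hd s).1 fun i => by
    have : ∑ j, b i j * s j = ∑ j, b i j * v j - ∑ j, b i j * (v j - s j) := by
      rw [← Finset.sum_sub_distrib]
      exact Finset.sum_congr rfl fun j _ => by ring
    rw [this]
    exact dvd_sub (hv i) (Finset.dvd_sum fun j _ => (hs j).mul_left _)
  have h2 := (hd (Pi.single j (s j))).2 (fun l => by
    rcases eq_or_ne l j with rfl | hl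
    · simpa using h1 l
    · simp [hl]) i
  rw [Finset.sum_eq_single j (by intro l _ hl; simp [hl]) (by simp), Pi.single_eq_same] at h2
  have : b i j * v j = b i j * s j + b i j * (v j - s j) := by ring
  rw [this]
  exact dvd_add h2 ((hs j).mul_left _)

variable {k : Type*} [Field k] {q : Matrix (Fin n) (Fin n) k}

/-- Take `d j` to be the lcm of the orders in column `j`. Multiplying the `i`-th congruence by the
orders of the other entries of row `i` kills all terms but one, and coprimality then removes the
multiplier. -/
lemma of_pairwiseCoprimeOrders (hN : 0 < N) (hb0 : ∀ i, b i i = 0) (hb : ∀ i j, b j i = -b i j)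
    (hq : ∀ i j (m : ℕ), q i j ^ m = 1 ↔ (N : ℤ) ∣ b i j * m) (h : PairwiseCoprimeOrders q) :
    HasDiagonalSolutions N b := by
  have ho : ∀ i j (m : ℕ), orderOf (q i j) ∣ m ↔ (N : ℤ) ∣ b i j * m := fun i j m => by
    rw [orderOf_dvd_iff_pow_eq_one, hq]
  have hsymm : ∀ i j, orderOf (q j i) = orderOf (q i j) := fun i j => by
    refine Nat.dvd_antisymm ?_ ?_
    · rw [ho, hb i j, neg_mul, dvd_neg, ← ho]
    · rw [ho, hb j i, neg_mul, dvd_neg, ← ho]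
  have hdiag : ∀ i, orderOf (q i i) = 1 := fun i => by
    rw [← Nat.dvd_one, ho, hb0]; simp
  have hcop : ∀ i j j', j ≠ j' → (orderOf (q i j)).Coprime (orderOf (q i j')) := by
    intro i j j' hj
    rcases lt_trichotomy i j with h1 | rfl | h1
    · rcases lt_trichotomy i j' with h2 | rfl | h2
      · exact h (x := (i, j)) h1 (y := (i, j')) h2 (by simpa using hj)
      · simp [hdiag]
      · rw [hsymm j' i]
        exact h (x := (i, j)) h1 (y := (j', i)) h2 (by simp [h2.ne'])
    · simp [hdiag]
    · rw [hsymm j i]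
      rcases lt_trichotomy i j' with h2 | rfl | h2
      · exact h (x := (j, i)) h1 (y := (i, j')) h2 (by simp [h1.ne])
      · simp [hdiag]
      · rw [hsymm j' i]
        exact h (x := (j, i)) h1 (y := (j', i)) h2 (by simpa using hj)
  have hpos : ∀ i j, 0 < orderOf (q i j) := fun i j =>
    Nat.pos_of_dvd_of_pos ((ho i j N).2 (dvd_mul_left _ _)) hN
  refine ⟨fun j => Finset.univ.lcm fun i => orderOf (q i j), fun j => ?_, fun s => ?_⟩
  · refine Nat.pos_of_ne_zero fun h0 => ?_
    obtain ⟨i, -, hi⟩ := Finset.lcm_eq_zero_iff.1 h0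
    exact (hpos i j).ne' hi
  · constructor
    · intro hs j
      refine Finset.lcm_dvd fun i _ => ?_
      have hprod : orderOf (q i j) ∣ (∏ l ∈ Finset.univ.erase j, orderOf (q i l)) * s j := by
        rw [ho]
        have hi := (hs i).mul_left ((∏ l ∈ Finset.univ.erase j, orderOf (q i l) : ℕ) : ℤ)
        rw [← Finset.add_sum_erase _ _ (Finset.mem_univ j), mul_add, Finset.mul_sum] at hi
        have h2 := (Int.dvd_add_left (Finset.dvd_sum fun l hl => ?_)).1 hi
        · convert h2 using 1
          push_cast; ring
        · obtain ⟨r, hr⟩ := Finset.dvd_prod_of_mem (fun l => orderOf (q i l)) hl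
          have := (ho i l (orderOf (q i l))).1 dvd_rfl
          rw [hr]
          convert this.mul_right (r * s l : ℤ) using 1
          push_cast; ring
      exact (Nat.Coprime.prod_right fun l hl =>
        hcop i j l (Finset.ne_of_mem_erase hl).symm).dvd_of_dvd_mul_left hprod
    · intro hs i
      exact Finset.dvd_sum fun j _ => (ho i j _).1
        ((Finset.dvd_lcm (Finset.mem_univ i)).trans (hs j))

/-- If the products of distinct entries vanish modulo `N` and no prime divisor of `N` divides all
entries, then the additive orders of the entries are pairwise coprime. -/
lemma pairwiseCoprimeOrders_of_dvd_mul (hb0 : ∀ i, b i i = 0) (hb : ∀ i j, b j i = -b i j)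
    (hq : ∀ i j (m : ℕ), q i j ^ m = 1 ↔ (N : ℤ) ∣ b i j * m)
    (hprime : ∀ r : ℕ, r.Prime → r ∣ N → ¬ ∀ i j, (r : ℤ) ∣ b i j)
    (h : ∀ i j k l, i ≠ k → i ≠ l → (N : ℤ) ∣ b i j * b k l) : PairwiseCoprimeOrders q := by
  have hmul : ∀ i j k l, i < j → k < l → (i, j) ≠ (k, l) → (N : ℤ) ∣ b i j * b k l := by
    intro i j k l hij hkl hne
    -- If the two pairs share `i`, then `j` lies outside the second pair, and skew-symmetry
    -- exchanges `i` and `j`.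
    by_cases h1 : i = k ∨ i = l
    · have hjk : j ≠ k := by rcases h1 with rfl | rfl <;> order
      have hjl : j ≠ l := by
        rcases h1 with rfl | rfl
        · rintro rfl; exact hne rfl
        · exact hij.ne'
      rw [hb j i, neg_mul, dvd_neg]
      exact h _ _ _ _ hjk hjl
    · push Not at h1
      exact h _ _ _ _ h1.1 h1.2
  have hdvd : ∀ i j (m : ℤ), (N : ℤ) ∣ b i j * m → (orderOf (q i j) : ℤ) ∣ m := by
    intro i j m hm
    rw [Int.natCast_dvd, orderOf_dvd_iff_pow_eq_one, hq]
    rcases Int.natAbs_eq m with e | e <;> rw [e] at hm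
    · exact hm
    · rwa [mul_neg, dvd_neg] at hm
  rintro ⟨i, j⟩ hij ⟨k, l⟩ hkl hne
  have hij : i < j := hij
  have hkl : k < l := hkl
  -- A prime `r` dividing both orders divides every entry: the order at `(i, j)` divides all other
  -- entries above the diagonal, and the order at `(k, l)` divides `b i j`.
  refine Nat.coprime_of_dvd fun r hr h1 h2 => ?_
  have hrN : r ∣ N := h1.trans (orderOf_dvd_of_pow_eq_one ((hq i j N).2 (dvd_mul_left _ _)))
  have hlt : ∀ u v, u < v → (r : ℤ) ∣ b u v := fun u v huv => by
    by_cases e : (i, j) = (u, v)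
    · exact (Int.natCast_dvd_natCast.2 h2).trans
        (hdvd k l _ (hmul k l u v hkl huv (e ▸ hne.symm)))
    · exact (Int.natCast_dvd_natCast.2 h1).trans (hdvd i j _ (hmul i j u v hij huv e))
  refine hprime r hr hrN fun u v => ?_
  rcases lt_trichotomy u v with huv | rfl | huv
  · exact hlt u v huv
  · simp [hb0]
  · rw [hb v u, dvd_neg]
    exact hlt v u huv

/-- For `n = 3`, the kernel vector of `b` shows that the products of distinct entries vanish. -/
lemma dvd_mul_three {N : ℕ} {b : Matrix (Fin 3) (Fin 3) ℤ} (h : HasDiagonalSolutions N b)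
    (hN : 0 < N) (hb0 : ∀ i, b i i = 0) (hb : ∀ i j, b j i = -b i j) (i j k l : Fin 3)
    (hik : i ≠ k) (hil : i ≠ l) : (N : ℤ) ∣ b i j * b k l := by
  have key := fun i j => h.dvd_mul hN (v := ![b 1 2, -b 0 2, b 0 1]) (fun i => by
    have : ∑ j, b i j * ![b 1 2, -b 0 2, b 0 1] j = 0 := by
      fin_cases i <;> simp [Fin.sum_univ_three, hb0, hb 0 1, hb 0 2, hb 1 2] <;> ring
    rw [this]
    exact dvd_zero _) j i
  -- Up to sign, `v i` is the entry whose indices avoid `i`.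
  have hv : b k l = ![b 1 2, -b 0 2, b 0 1] i ∨ b k l = -![b 1 2, -b 0 2, b 0 1] i ∨
      b k l = 0 := by
    fin_cases i <;> fin_cases k <;> fin_cases l <;>
      simp [hb0, hb 0 1, hb 0 2, hb 1 2] at hik hil ⊢
  have := key i j
  rcases hv with e | e | e <;> rw [e, hb j i]
  · rw [neg_mul, dvd_neg]; exact this
  · rw [neg_mul_neg]; exact this
  · simp

/-! ### Size four: the Pfaffian adjugate and the change of modulus. -/

lemma pfaffian_four (b : Matrix (Fin 4) (Fin 4) ℤ) :
    pfaffian 4 b = b 0 1 * b 2 3 - b 0 2 * b 1 3 + b 0 3 * b 1 2 := by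
  simp [pfaffian, Fin.sum_univ_succ, Fin.succAbove]
  ring

/-- The Pfaffian adjugate of a skew-symmetric matrix of size four. -/
def pfaffianAdjugate (b : Matrix (Fin 4) (Fin 4) ℤ) : Matrix (Fin 4) (Fin 4) ℤ :=
  !![0, b 2 3, -b 1 3, b 1 2; -b 2 3, 0, b 0 3, -b 0 2; b 1 3, -b 0 3, 0, b 0 1;
    -b 1 2, b 0 2, -b 0 1, 0]

lemma mul_pfaffianAdjugate {b : Matrix (Fin 4) (Fin 4) ℤ} (hb0 : ∀ i, b i i = 0)
    (hb : ∀ i j, b j i = -b i j) : b * pfaffianAdjugate b = -pfaffian 4 b • 1 := by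
  ext i j
  fin_cases i <;> fin_cases j <;>
    simp [Matrix.mul_apply, Fin.sum_univ_four, pfaffianAdjugate, pfaffian_four, hb0, hb 0 1,
      hb 0 2, hb 0 3, hb 1 2, hb 1 3, hb 2 3] <;> ring

lemma pfaffianAdjugate_mul {b : Matrix (Fin 4) (Fin 4) ℤ} (hb0 : ∀ i, b i i = 0)
    (hb : ∀ i j, b j i = -b i j) : pfaffianAdjugate b * b = -pfaffian 4 b • 1 := by
  ext i j
  fin_cases i <;> fin_cases j <;>
    simp [Matrix.mul_apply, Fin.sum_univ_four, pfaffianAdjugate, pfaffian_four, hb0, hb 0 1,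
      hb 0 2, hb 0 3, hb 1 2, hb 1 3, hb 2 3] <;> ring

/-- For `n = 4` and vanishing Pfaffian, the columns of the Pfaffian adjugate show that the products
of distinct entries vanish. -/
lemma dvd_mul_four {N : ℕ} {b : Matrix (Fin 4) (Fin 4) ℤ} (h : HasDiagonalSolutions N b)
    (hN : 0 < N) (hb0 : ∀ i, b i i = 0) (hb : ∀ i j, b j i = -b i j)
    (hpf : (N : ℤ) ∣ pfaffian 4 b) (i j k l : Fin 4) (hik : i ≠ k) (hil : i ≠ l) :
    (N : ℤ) ∣ b i j * b k l := by
  have key := fun m i j => h.dvd_mul hN (v := fun j => pfaffianAdjugate b j m) (fun i => by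
    rw [← Matrix.mul_apply, mul_pfaffianAdjugate hb0 hb]
    simpa using (hpf.mul_right _)) j i
  have hv : ∃ m, b k l = pfaffianAdjugate b i m ∨ b k l = -pfaffianAdjugate b i m := by
    by_cases hkl : k = l
    · refine ⟨i, Or.inl ?_⟩
      rw [hkl, hb0]
      fin_cases i <;> simp [pfaffianAdjugate]
    -- This is the fourth index, because `0 + 1 + 2 + 3 = 2` in `Fin 4`.
    · refine ⟨2 - i - k - l, ?_⟩
      fin_cases i <;> fin_cases k <;> fin_cases l <;>
        simp [pfaffianAdjugate, hb 0 1, hb 0 2, hb 0 3, hb 1 2, hb 1 3, hb 2 3,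
          show (-1 - 3 : Fin 4) = 0 from rfl, show (-3 - 1 : Fin 4) = 0 from rfl] at hik hil hkl ⊢
  obtain ⟨m, e | e⟩ := hv <;> rw [e, hb j i]
  · rw [neg_mul, dvd_neg]; exact key m i j
  · rw [neg_mul_neg]; exact key m i j

lemma dvd_sum_smul_iff {n m ρ : ℕ} {b : Matrix (Fin n) (Fin n) ℤ} (hm : 0 < m)
    (s : Fin n → ℕ) (i : Fin n) :
    ((m * ρ : ℕ) : ℤ) ∣ ∑ j, b i j * (m • s) j ↔ (ρ : ℤ) ∣ ∑ j, b i j * s j := by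
  have : ∑ j, b i j * (m • s) j = m * ∑ j, b i j * s j := by
    rw [Finset.mul_sum]
    exact Finset.sum_congr rfl fun j _ => by simp; ring
  rw [this, Nat.cast_mul, mul_dvd_mul_iff_left (by positivity)]

/-- A vector `s` solves modulo `ρ` exactly when `m • s` solves modulo `m * ρ`, and `d i ∣ m * s i`
means `d i / gcd (d i) m ∣ s i`. -/
lemma exists_scaled {n : ℕ} {m ρ : ℕ} {b : Matrix (Fin n) (Fin n) ℤ} (hm : 0 < m)
    (h : HasDiagonalSolutions (m * ρ) b) : HasDiagonalSolutions ρ b := by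
  obtain ⟨d, hd, hs⟩ := h
  refine ⟨fun i => d i / (d i).gcd m, fun i => Nat.div_pos
    (Nat.le_of_dvd (hd i) (Nat.gcd_dvd_left _ _)) (Nat.gcd_pos_of_pos_right _ hm), fun s => ?_⟩
  have h1 := hs (m • s)
  simp only [dvd_sum_smul_iff hm] at h1
  rw [h1]
  refine forall_congr' fun i => ?_
  have hg : 0 < (d i).gcd m := Nat.gcd_pos_of_pos_right _ hm
  have hc := Nat.coprime_div_gcd_div_gcd hg
  have e1 := Nat.mul_div_cancel' (Nat.gcd_dvd_left (d i) m)
  have e2 := Nat.mul_div_cancel' (Nat.gcd_dvd_right (d i) m)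
  rw [Pi.smul_apply, smul_eq_mul]
  constructor
  · intro h
    refine hc.dvd_of_dvd_mul_left ((Nat.mul_dvd_mul_iff_left hg).1 ?_)
    rwa [e1, ← mul_assoc, e2]
  · rintro ⟨r, hr⟩
    refine ⟨r * (m / (d i).gcd m), ?_⟩
    calc m * s i = (d i).gcd m * (m / (d i).gcd m) * (d i / (d i).gcd m * r) := by rw [e2, hr]
      _ = (d i).gcd m * (d i / (d i).gcd m) * (r * (m / (d i).gcd m)) := by ring
      _ = d i * (r * (m / (d i).gcd m)) := by rw [e1]

lemma scale {n : ℕ} {m ρ : ℕ} {b : Matrix (Fin n) (Fin n) ℤ} (hm : 0 < m)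
    (hdvd : ∀ s : Fin n → ℕ, (∀ i, ((m * ρ : ℕ) : ℤ) ∣ ∑ j, b i j * s j) → ∀ i, m ∣ s i)
    (h : HasDiagonalSolutions ρ b) : HasDiagonalSolutions (m * ρ) b := by
  obtain ⟨d, hd, hs⟩ := h
  refine ⟨m • d, fun i => Nat.mul_pos hm (hd i), fun s => ?_⟩
  suffices H : ∀ t : Fin n → ℕ, (∀ i, ((m * ρ : ℕ) : ℤ) ∣ ∑ j, b i j * (m • t) j) ↔
      ∀ i, (m • d) i ∣ (m • t) i by
    by_cases hms : ∀ i, m ∣ s i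
    · choose t ht using hms
      obtain rfl : s = m • t := funext ht
      exact H t
    · exact iff_of_false (fun h => hms (hdvd s h))
        fun h => hms fun i => (Dvd.intro _ rfl).trans (h i)
  intro t
  simp only [dvd_sum_smul_iff hm, hs]
  simp only [Pi.smul_apply, smul_eq_mul, mul_dvd_mul_iff_left hm.ne']

/-- Write `ℓ = m ρ` and `pf = ρ f` with `m` and `f` coprime. Applying the adjugate to `B s ≡ 0`
gives `ℓ ∣ pf * s i`, hence `m ∣ s i`; so solutions modulo `ℓ` are `m` times those modulo `ρ`. -/
lemma four_of_dvd {ℓ ρ : ℕ} {b : Matrix (Fin 4) (Fin 4) ℤ} (hℓ : 0 < ℓ)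
    (hb0 : ∀ i, b i i = 0) (hb : ∀ i j, b j i = -b i j) (hρ : ρ = Int.gcd ℓ (pfaffian 4 b)) :
    HasDiagonalSolutions ℓ b ↔ HasDiagonalSolutions ρ b := by
  have hρ0 : 0 < ρ := hρ ▸ Int.gcd_pos_of_ne_zero_left _ (by omega)
  obtain ⟨m, hm⟩ : ρ ∣ ℓ := by
    rw [hρ, ← Int.natCast_dvd_natCast]
    exact Int.gcd_dvd_left _ _
  have hm0 : 0 < m := Nat.pos_of_ne_zero fun h => by simp [h] at hm; omega
  rw [mul_comm] at hm
  obtain ⟨f, hf⟩ : (ρ : ℤ) ∣ pfaffian 4 b := hρ ▸ Int.gcd_dvd_right _ _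
  have hcop : IsCoprime (m : ℤ) f := by
    rw [Int.isCoprime_iff_gcd_eq_one]
    have : Int.gcd ((ρ : ℤ) * m) (ρ * f) = ρ := by
      rw [← hf, mul_comm, ← Nat.cast_mul, ← hm, hρ]
    rw [Int.gcd_mul_left, Int.natAbs_natCast] at this
    exact Nat.eq_of_mul_eq_mul_left hρ0 (this.trans (mul_one _).symm)
  rw [hm]
  refine ⟨exists_scaled hm0, scale hm0 fun s hs i => ?_⟩
  have h1 : ((m * ρ : ℕ) : ℤ) ∣ pfaffian 4 b * s i := by
    have h2 : (pfaffianAdjugate b).mulVec (b.mulVec fun j => (s j : ℤ)) i =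
        -(pfaffian 4 b * s i) := by
      rw [Matrix.mulVec_mulVec, pfaffianAdjugate_mul hb0 hb, Matrix.smul_mulVec,
        Matrix.one_mulVec]
      simp
    rw [← dvd_neg, ← h2]
    simp only [Matrix.mulVec, dotProduct]
    exact Finset.dvd_sum fun l _ => (hs l).mul_left _
  rw [hf, Nat.cast_mul, mul_comm (m : ℤ), mul_assoc, mul_dvd_mul_iff_left (by positivity)] at h1
  exact_mod_cast hcop.dvd_of_dvd_mul_left h1

end HasDiagonalSolutions

/-! ### Translation to the center and the cases of two, three and four variables. -/

namespace IsSkewPolyPresentation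

open SkewPoly

variable {k : Type*} [Field k] {n : ℕ} {p : Matrix (Fin n) (Fin n) k} {ξ : k} {ℓ : ℕ}
  {b : Matrix (Fin n) (Fin n) ℤ}

lemma pos (h : IsSkewPolyPresentation p ξ ℓ b) : 0 < ℓ := by have := h.one_lt; omega

lemma mul_swap (h : IsSkewPolyPresentation p ξ ℓ b) (i j : Fin n) : p i j * p j i = 1 := by
  rw [h.param_eq, h.param_eq, h.skew i j, zpow_neg,
    mul_inv_cancel₀ (zpow_ne_zero _ (h.primitive.ne_zero h.pos.ne'))]

lemma diag_eq_one (h : IsSkewPolyPresentation p ξ ℓ b) (i : Fin n) : p i i = 1 := by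
  rw [h.param_eq, h.diag_zero, zpow_zero]

lemma pow_eq_one_iff (h : IsSkewPolyPresentation p ξ ℓ b) (i j : Fin n) (m : ℕ) :
    p i j ^ m = 1 ↔ (ℓ : ℤ) ∣ b i j * m := by
  rw [h.param_eq, ← zpow_natCast, ← zpow_mul, h.primitive.zpow_eq_one_iff_dvd]

/-- Otherwise `ξ ^ r`, of order `ℓ / r`, would also present `p`, against minimality. -/
lemma not_forall_dvd (h : IsSkewPolyPresentation p ξ ℓ b) {r : ℕ} (hr : r.Prime) (hrℓ : r ∣ ℓ) :
    ¬ ∀ i j, (r : ℤ) ∣ b i j := by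
  intro hb
  choose c hc using hb
  obtain ⟨m, rfl⟩ := hrℓ
  have hm : 0 < m := Nat.pos_of_mul_pos_left h.pos
  have := h.minimal m (ξ ^ r) c hm (h.primitive.pow h.pos rfl) fun i j => by
    rw [h.param_eq, hc, zpow_mul, zpow_natCast]
  nlinarith [hr.two_le]

lemma mem_centralExponents_iff (h : IsSkewPolyPresentation p ξ ℓ b) (s : Fin n → ℕ) :
    s ∈ centralExponents p ↔ ∀ i, (ℓ : ℤ) ∣ ∑ j, b i j * s j := by
  rw [mem_centralExponents]
  refine forall_congr' fun i => ?_
  have (S : Finset (Fin n)) : ∏ j ∈ S, p j i ^ s j = ξ ^ (-∑ j ∈ S, b i j * s j) := by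
    induction S using Finset.induction_on with
    | empty => simp
    | insert a S ha ih =>
      rw [Finset.prod_insert ha, Finset.sum_insert ha, ih, neg_add,
        zpow_add₀ (h.primitive.ne_zero h.pos.ne'), h.param_eq, h.skew i a, ← zpow_natCast,
        ← zpow_mul, neg_mul]
  rw [this, h.primitive.zpow_eq_one_iff_dvd, dvd_neg]

lemma isTwistedMonoidBasis (h : IsSkewPolyPresentation p ξ ℓ b) :
    IsTwistedMonoidBasis (A := center p) (centerBasis h.mul_swap h.diag_eq_one)
      fun s t => cocycle p s.1 t.1 where
  ne_zero _ _ := cocycle_ne_zero h.mul_swap _ _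
  basis_zero := Subtype.ext <| by rw [coe_centerBasis]; exact monomial_zero _ _
  mul s t := Subtype.ext <| by
    simp only [MulMemClass.coe_mul, SetLike.val_smul, coe_centerBasis, monomial_mul_monomial]
    rfl

lemma single_mem (h : IsSkewPolyPresentation p ξ ℓ b) (i : Fin n) :
    Pi.single i ℓ ∈ centralExponents p := by
  rw [h.mem_centralExponents_iff]
  intro j
  refine Finset.dvd_sum fun l _ => ?_
  rcases eq_or_ne l i with rfl | hl
  · simp
  · simp [hl]

lemma isRegularRing_center_iff (h : IsSkewPolyPresentation p ξ ℓ b) :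
    IsRegularRing (center p) ↔ HasDiagonalSolutions ℓ b := by
  rw [h.isTwistedMonoidBasis.isRegularRing_iff h.pos h.single_mem]
  simp only [h.mem_centralExponents_iff, HasDiagonalSolutions]

lemma isPolynomialRingIn_center_iff (h : IsSkewPolyPresentation p ξ ℓ b) :
    IsPolynomialRingIn k n (center p) ↔ HasDiagonalSolutions ℓ b := by
  rw [h.isTwistedMonoidBasis.isPolynomialRingIn_iff h.pos h.single_mem]
  simp only [h.mem_centralExponents_iff, HasDiagonalSolutions]

lemma center_eq_adjoin (h : IsSkewPolyPresentation p ξ ℓ b) {d : Fin n → ℕ} (hd : ∀ i, 0 < d i)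
    (hM : ∀ s, s ∈ centralExponents p ↔ ∀ i, d i ∣ s i) :
    center p = Algebra.adjoin k (Set.range fun i => x p i ^ d i) := by
  have htop := AlgHom.range_eq_top _ |>.2 (h.isTwistedMonoidBasis.aeval_bijective
    (IsTwistedMonoidBasis.scaleEquiv hd hM)).2
  rw [← Algebra.adjoin_range_eq_range_aeval] at htop
  have := congrArg (Subalgebra.map (center p).val) htop
  rw [AlgHom.map_adjoin, Algebra.map_top, Subalgebra.range_val, ← Set.range_comp] at this
  rw [← this]
  congr 2
  ext1 i
  simp only [Function.comp_apply, Subalgebra.coe_val, coe_centerBasis,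
    IsTwistedMonoidBasis.scaleEquiv_single, x_pow_eq_monomial h.mul_swap h.diag_eq_one]

lemma mem_centralExponents_two {p : Matrix (Fin 2) (Fin 2) k} {b : Matrix (Fin 2) (Fin 2) ℤ}
    (h : IsSkewPolyPresentation p ξ ℓ b) (s : Fin 2 → ℕ) :
    s ∈ centralExponents p ↔ ∀ i, ℓ ∣ s i := by
  have hcop : IsCoprime (ℓ : ℤ) (b 0 1) := by
    rw [Int.isCoprime_iff_gcd_eq_one]
    by_contra hne
    obtain ⟨r, hr, hrg⟩ := Nat.exists_prime_and_dvd hne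
    have h1 : (r : ℤ) ∣ ℓ := (Int.natCast_dvd_natCast.2 hrg).trans (Int.gcd_dvd_left _ _)
    have h2 : (r : ℤ) ∣ b 0 1 := (Int.natCast_dvd_natCast.2 hrg).trans (Int.gcd_dvd_right _ _)
    refine h.not_forall_dvd hr (Int.natCast_dvd_natCast.1 h1) fun i j => ?_
    fin_cases i <;> fin_cases j <;> simp [h.diag_zero, h.skew 0 1, h2]
  rw [h.mem_centralExponents_iff]
  have key : ∀ m : ℕ, (ℓ : ℤ) ∣ b 0 1 * m ↔ ℓ ∣ m := fun m =>
    ⟨fun h => Int.natCast_dvd_natCast.1 (hcop.dvd_of_dvd_mul_left h),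
      fun h => (Int.natCast_dvd_natCast.2 h).mul_left _⟩
  simp [Fin.forall_fin_two, Fin.sum_univ_two, h.diag_zero, h.skew 0 1, key, and_comm]

lemma hasDiagonalSolutions_three {p : Matrix (Fin 3) (Fin 3) k} {b : Matrix (Fin 3) (Fin 3) ℤ}
    (h : IsSkewPolyPresentation p ξ ℓ b) :
    HasDiagonalSolutions ℓ b ↔ PairwiseCoprimeOrders p :=
  ⟨fun hD => HasDiagonalSolutions.pairwiseCoprimeOrders_of_dvd_mul h.diag_zero h.skew
      h.pow_eq_one_iff (fun _ hr hrℓ => h.not_forall_dvd hr hrℓ)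
      (hD.dvd_mul_three h.pos h.diag_zero h.skew),
    HasDiagonalSolutions.of_pairwiseCoprimeOrders h.pos h.diag_zero h.skew h.pow_eq_one_iff⟩

/-- Modulo `ρ`, the residues of `gcd(b_ij, ρ)` and `b_ij` have the same additive order. -/
lemma gcdPowerMatrix_pow_eq_one_iff {ρ : ℕ} {ω : k} (hω : IsPrimitiveRoot ω ρ) (i j : Fin n)
    (m : ℕ) : gcdPowerMatrix b ρ ω i j ^ m = 1 ↔ (ρ : ℤ) ∣ b i j * m := by
  rw [gcdPowerMatrix, Matrix.of_apply, ← pow_mul, hω.pow_eq_one_iff_dvd]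
  rw [← Int.natCast_dvd_natCast, Nat.cast_mul]
  rw [Int.natCast_dvd, Int.natCast_dvd, Int.natAbs_mul, Int.natAbs_mul]
  simp only [Int.natAbs_natCast, Int.gcd]
  constructor
  · exact fun h => h.trans (Nat.mul_dvd_mul_right (Nat.gcd_dvd_left _ _) _)
  · intro h
    rw [← Nat.gcd_mul_right]
    exact Nat.dvd_gcd h (dvd_mul_right _ _)

/-- Modulo `ρ` the Pfaffian vanishes, so the adjugate columns are solutions; primes dividing `ρ`
divide `ℓ`, so the minimality of `ℓ` still applies. -/
lemma hasDiagonalSolutions_four {p : Matrix (Fin 4) (Fin 4) k} {b : Matrix (Fin 4) (Fin 4) ℤ}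
    (h : IsSkewPolyPresentation p ξ ℓ b) {ρ : ℕ} {ω : k} (hρ : ρ = Int.gcd ℓ (pfaffian 4 b))
    (hω : IsPrimitiveRoot ω ρ) :
    HasDiagonalSolutions ℓ b ↔ PairwiseCoprimeOrders (gcdPowerMatrix b ρ ω) := by
  have hρ0 : 0 < ρ := hρ ▸ Int.gcd_pos_of_ne_zero_left _ (by have := h.pos; omega)
  have hρℓ : ρ ∣ ℓ := Int.natCast_dvd_natCast.1 (hρ ▸ Int.gcd_dvd_left _ _)
  rw [HasDiagonalSolutions.four_of_dvd h.pos h.diag_zero h.skew hρ]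
  exact ⟨fun hD => HasDiagonalSolutions.pairwiseCoprimeOrders_of_dvd_mul h.diag_zero h.skew
      (gcdPowerMatrix_pow_eq_one_iff hω) (fun _ hr hrρ => h.not_forall_dvd hr (hrρ.trans hρℓ))
      (hD.dvd_mul_four hρ0 h.diag_zero h.skew (hρ ▸ Int.gcd_dvd_right _ _)),
    HasDiagonalSolutions.of_pairwiseCoprimeOrders hρ0 h.diag_zero h.skew
      (gcdPowerMatrix_pow_eq_one_iff hω)⟩

end IsSkewPolyPresentation

theorem theorem0p7 {k : Type*} [Field k] [CharZero k] :
    (∀ (p : Matrix (Fin 2) (Fin 2) k) (ξ : k) (ℓ : ℕ) (b : Matrix (Fin 2) (Fin 2) ℤ),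
      IsSkewPolyPresentation p ξ ℓ b →
        SkewPoly.center p = Algebra.adjoin k {SkewPoly.x p 0 ^ ℓ, SkewPoly.x p 1 ^ ℓ} ∧
        IsRegularRing (SkewPoly.center p) ∧
        IsPolynomialRingIn k 2 (SkewPoly.center p)) ∧
    (∀ (p : Matrix (Fin 3) (Fin 3) k) (ξ : k) (ℓ : ℕ) (b : Matrix (Fin 3) (Fin 3) ℤ),
      IsSkewPolyPresentation p ξ ℓ b →
        (IsRegularRing (SkewPoly.center p) ↔ PairwiseCoprimeOrders p) ∧
        (IsPolynomialRingIn k 3 (SkewPoly.center p) ↔ PairwiseCoprimeOrders p)) ∧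
    (∀ (p : Matrix (Fin 4) (Fin 4) k) (ξ : k) (ℓ : ℕ) (b : Matrix (Fin 4) (Fin 4) ℤ),
      IsSkewPolyPresentation p ξ ℓ b →
        ∀ (ρ : ℕ) (ω : k), ρ = Int.gcd (ℓ : ℤ) (pfaffian 4 b) → IsPrimitiveRoot ω ρ →
          (IsRegularRing (SkewPoly.center p) ↔ PairwiseCoprimeOrders (gcdPowerMatrix b ρ ω)) ∧
          (IsPolynomialRingIn k 4 (SkewPoly.center p) ↔
            PairwiseCoprimeOrders (gcdPowerMatrix b ρ ω))) := by
  refine ⟨fun p ξ ℓ b h => ?_, fun p ξ ℓ b h => ⟨?_, ?_⟩, fun p ξ ℓ b h ρ ω hρ hω => ⟨?_, ?_⟩⟩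
  · have hD : HasDiagonalSolutions ℓ b := ⟨fun _ => ℓ, fun _ => h.pos, fun s => by
      rw [← h.mem_centralExponents_iff, h.mem_centralExponents_two]⟩
    refine ⟨?_, h.isRegularRing_center_iff.2 hD, h.isPolynomialRingIn_center_iff.2 hD⟩
    rw [h.center_eq_adjoin (fun _ => h.pos) h.mem_centralExponents_two]
    congr 1
    ext y
    simp [Fin.exists_fin_two, eq_comm]
  · rw [h.isRegularRing_center_iff, h.hasDiagonalSolutions_three]
  · rw [h.isPolynomialRingIn_center_iff, h.hasDiagonalSolutions_three]
  · rw [h.isRegularRing_center_iff, h.hasDiagonalSolutions_four hρ hω]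
  · rw [h.isPolynomialRingIn_center_iff, h.hasDiagonalSolutions_four hρ hω]
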